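/- All modules are right modules, and $\operatorname{mod} A$ denotes the category of finitely generated right $A$-modules. Let $R$ be a (left and right) noetherian, semiperfect, basic ring, let $e\in R$ be an idempotent, let $\langle 1-e\rangle$ be the two-sided ideal generated by $1-e$, let $\Gamma_e=(1-e)R(1-e)$ (a ring with unit $1-e$), and let $F_e=-\otimes_R R(1-e)$, a functor from right $R$-modules to right $\Gamma_e$-modules. Regard $\operatorname{mod} R/\langle 1-e\rangle$ as the full subcategory of $\operatorname{mod} R$ of modules annihilated by $\langle 1-e\rangle$. An envelope of $\Omega\in\operatorname{mod} R$ in this subcategory is a morphism $f\colon\Omega\to X$ with $X\in\operatorname{mod} R/\langle 1-e\rangle$ through which every morphism from $\Omega$ to an object of $\operatorname{mod} R/\langle 1-e\rangle$ factors, and such that every endomorphism $g$ of $X$ with $g\circ f=f$ is an isomorphism. Theorem. Let $\Omega_0\in\operatorname{mod} R$. Then one can choose inductively, for all $i\ge 0$, objects $\Omega_{i+1},X_i,K_i,P_i$ of $\operatorname{mod} R$ and morphisms (1) $f_i\colon\Omega_i\to X_i$, a $\operatorname{mod} R/\langle 1-e\rangle$-envelope of $\Omega_i$; (2) $k_i\colon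 K_i\to\Omega_i$, a kernel of $f_i$; (3) $g_i\colon P_i\to K_i$, a projective cover of $K_i$; (4) $h_i\colon\Omega_{i+1}\to P_i$, a kernel of $g_i$. For every such choice, the augmented complex of right $\Gamma_e$-modules $$\cdots\to F_e(P_2)\xrightarrow{d_1}F_e(P_1)\xrightarrow{d_0}F_e(P_0)\xrightarrow{\varepsilon}F_e(\Omega_0)\to 0,$$ $$d_i=F_e(h_i\circ k_{i+1}\circ g_{i+1}),\qquad \varepsilon=F_e(k_0\circ g_0),$$ is a minimal projective resolution of $F_e(\Omega_0)$ by finitely generated projective $\Gamma_e$-modules; that is, it is exact, and $\varepsilon$ and all the maps $F_e(P_{i+1})\to\operatorname{im} d_i$ are projective covers (surjections from a projective module with superfluous kernel). -/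

import Mathlib

/-! Right modules over a ring `R` are modules over `Rᵐᵒᵖ`: the right action of `r` on `m` is
`MulOpposite.op r • m`. The category of finitely generated right `R`-modules (`mod R`) is
`FGModuleCat Rᵐᵒᵖ`. -/

universe u v w

namespace IdempotentReduction

open scoped TensorProduct

/-! ### Semiperfect and basic rings -/

section Rings

variable (R : Type u) [Ring R]

/-- `R` is semiperfect: `R / rad R` is semisimple and idempotents lift modulo `rad R`. -/
structure IsSemiperfect : Prop where
  semisimple : IsSemisimpleRing (R ⧸ Ring.jacobson R)
  lift_idempotent : ∀ x : R ⧸ Ring.jacobson R, IsIdempotentElem x →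
    ∃ r : R, IsIdempotentElem r ∧ Ideal.Quotient.mk (Ring.jacobson R) r = x

variable {R}

/-- A primitive idempotent: a nonzero idempotent that is not the sum of two nonzero orthogonal
idempotents. -/
structure IsPrimitiveIdempotent (a : R) : Prop where
  idem : IsIdempotentElem a
  ne_zero : a ≠ 0
  eq_zero_or : ∀ b c : R, IsIdempotentElem b → IsIdempotentElem c → b * c = 0 → c * b = 0 →
    a = b + c → b = 0 ∨ c = 0

/-- The right ideal `aR`, as a right `R`-module. -/
abbrev rightIdeal (a : R) : Submodule Rᵐᵒᵖ R := Submodule.span Rᵐᵒᵖ {a}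

/-- The left ideal `Ra`, as a left `R`-module. -/
abbrev leftIdeal (a : R) : Submodule R R := Submodule.span R {a}

variable (R)

/-- A (semiperfect) ring is basic if `1` is a sum of pairwise orthogonal primitive idempotents
`a₁, …, aₙ` such that the right modules `aᵢR` are pairwise non-isomorphic. -/
def IsBasic : Prop :=
  ∃ (n : ℕ) (a : Fin n → R), CompleteOrthogonalIdempotents a ∧
    (∀ i, IsPrimitiveIdempotent (a i)) ∧
    ∀ i j, i ≠ j → IsEmpty (rightIdeal (a i) ≃ₗ[Rᵐᵒᵖ] rightIdeal (a j))

end Rings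

/-! ### The tensor product `M ⊗_R N` of a right module and a left module -/

section Tensor

variable (R : Type u) [Ring R]

/-- The subgroup of `M ⊗_ℤ N` generated by the elements `m r ⊗ n - m ⊗ r n`. -/
def balancedRel (M : Type v) [AddCommGroup M] [Module Rᵐᵒᵖ M] (N : Type w) [AddCommGroup N]
    [Module R N] : AddSubgroup (M ⊗[ℤ] N) :=
  AddSubgroup.closure {t | ∃ (m : M) (r : R) (n : N),
    t = (MulOpposite.op r • m) ⊗ₜ[ℤ] n - m ⊗ₜ[ℤ] (r • n)}

/-- The tensor product `M ⊗_R N` over a not necessarily commutative ring. -/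
def BalancedTensor (M : Type v) [AddCommGroup M] [Module Rᵐᵒᵖ M] (N : Type w) [AddCommGroup N]
    [Module R N] : Type (max v w) :=
  (M ⊗[ℤ] N) ⧸ balancedRel R M N

variable (M : Type v) [AddCommGroup M] [Module Rᵐᵒᵖ M] (N : Type w) [AddCommGroup N] [Module R N]

instance : AddCommGroup (BalancedTensor R M N) :=
  inferInstanceAs (AddCommGroup ((M ⊗[ℤ] N) ⧸ balancedRel R M N))

variable {M N}

/-- The pure tensor `m ⊗ n` in `M ⊗_R N`. -/
def pureTensor (m : M) (n : N) : BalancedTensor R M N :=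
  QuotientAddGroup.mk' (balancedRel R M N) (m ⊗ₜ[ℤ] n)

/-- Additive maps out of `M ⊗_R N` agree if they agree on pure tensors. -/
theorem balancedTensor_hom_ext {A : Type*} [AddCommGroup A] {f g : BalancedTensor R M N →+ A}
    (h : ∀ m n, f (pureTensor R m n) = g (pureTensor R m n)) : f = g := by
  ext x
  obtain ⟨t, rfl⟩ := QuotientAddGroup.mk'_surjective (balancedRel R M N) x
  induction t using TensorProduct.induction_on with
  | zero =>
    rw [map_zero]
    exact (map_zero f).trans (map_zero g).symm
  | tmul m n => exact h m n
  | add a b ha hb =>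
    rw [map_add]
    exact (map_add f _ _).trans ((congrArg₂ (· + ·) ha hb).trans (map_add g _ _).symm)

/-- `f ⊗ g : M ⊗_R N → M' ⊗_R N'`, on the level of additive groups. -/
def balancedMap {M' : Type*} [AddCommGroup M'] [Module Rᵐᵒᵖ M'] {N' : Type*} [AddCommGroup N']
    [Module R N'] (f : M →ₗ[Rᵐᵒᵖ] M') (g : N →ₗ[R] N') :
    BalancedTensor R M N →+ BalancedTensor R M' N' :=
  QuotientAddGroup.map (balancedRel R M N) (balancedRel R M' N')
    (TensorProduct.map f.toAddMonoidHom.toIntLinearMap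
      g.toAddMonoidHom.toIntLinearMap).toAddMonoidHom (by
      rw [balancedRel, AddSubgroup.closure_le]
      rintro _ ⟨m, r, n, rfl⟩
      refine AddSubgroup.subset_closure ⟨f m, r, g n, ?_⟩
      rw [map_sub]
      change f (MulOpposite.op r • m) ⊗ₜ[ℤ] g n - f m ⊗ₜ[ℤ] g (r • n) = _
      rw [map_smul, map_smul])

theorem balancedMap_pure {M' : Type*} [AddCommGroup M'] [Module Rᵐᵒᵖ M'] {N' : Type*}
    [AddCommGroup N'] [Module R N'] (f : M →ₗ[Rᵐᵒᵖ] M') (g : N →ₗ[R] N') (m : M) (n : N) :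
    balancedMap R f g (pureTensor R m n) = pureTensor R (f m) (g n) := rfl

section RightAction

variable {S : Type*} [Ring S] [Module Sᵐᵒᵖ N] [SMulCommClass R Sᵐᵒᵖ N]

/-- Right multiplication by `s` on an `R`-`S`-bimodule `N`, as a left `R`-linear map. -/
def rightMul (s : Sᵐᵒᵖ) : N →ₗ[R] N where
  toFun n := s • n
  map_add' := smul_add s
  map_smul' r n := (smul_comm r s n).symm

variable (M N) in
/-- The right `S`-action `(m ⊗ n) s = m ⊗ n s` on `M ⊗_R N` for an `R`-`S`-bimodule `N`. -/
def balancedAction : Sᵐᵒᵖ →+* AddMonoid.End (BalancedTensor R M N) where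
  toFun s := balancedMap R (LinearMap.id : M →ₗ[Rᵐᵒᵖ] M) (rightMul R s : N →ₗ[R] N)
  map_one' := balancedTensor_hom_ext R fun m n => by
    change pureTensor R m ((1 : Sᵐᵒᵖ) • n) = pureTensor R m n
    rw [one_smul]
  map_mul' s t := balancedTensor_hom_ext R fun m n => by
    change pureTensor R m ((s * t) • n) = pureTensor R m (s • t • n)
    rw [mul_smul]
  map_zero' := balancedTensor_hom_ext R fun m n => by
    change QuotientAddGroup.mk' (balancedRel R M N) (m ⊗ₜ[ℤ] ((0 : Sᵐᵒᵖ) • n)) = 0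
    rw [zero_smul, TensorProduct.tmul_zero, map_zero]
  map_add' s t := balancedTensor_hom_ext R fun m n => by
    change QuotientAddGroup.mk' (balancedRel R M N) (m ⊗ₜ[ℤ] ((s + t) • n)) =
      QuotientAddGroup.mk' (balancedRel R M N) (m ⊗ₜ[ℤ] (s • n)) + QuotientAddGroup.mk' (balancedRel R M N) (m ⊗ₜ[ℤ] (t • n))
    rw [add_smul, TensorProduct.tmul_add, map_add]

instance : Module Sᵐᵒᵖ (BalancedTensor R M N) :=
  Module.compHom _ (balancedAction R M N (S := S))

theorem smul_pureTensor (s : Sᵐᵒᵖ) (m : M) (n : N) :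
    s • pureTensor R m n = pureTensor R m (s • n) := rfl

end RightAction

end Tensor

/-! ### The ring `Γ_e = (1-e)R(1-e)` and the functor `F_e = - ⊗_R R(1-e)` -/

section Functor

variable {R : Type u} [Ring R]

/-- For an idempotent `p`, the left ideal `Rp` is a right `pRp`-module by multiplication. -/
instance leftIdealModule {p : R} (hp : IsIdempotentElem p) :
    Module hp.Cornerᵐᵒᵖ (leftIdeal p) where
  smul γ x := ⟨x.1 * γ.unop.1, by
    have h : γ.unop.1 * p = γ.unop.1 := ((Subsemigroup.mem_corner_iff hp).mp γ.unop.2).2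
    rw [← h, ← mul_assoc]
    exact Submodule.smul_mem _ _ (Submodule.mem_span_singleton_self p)⟩
  one_smul x := Subtype.ext <| by
    obtain ⟨a, ha⟩ := Submodule.mem_span_singleton.mp x.2
    change x.1 * p = x.1
    rw [← ha, smul_eq_mul, mul_assoc, hp.eq]
  mul_smul γ δ x := Subtype.ext (mul_assoc x.1 δ.unop.1 γ.unop.1).symm
  smul_zero γ := Subtype.ext (zero_mul γ.unop.1)
  smul_add γ x y := Subtype.ext (add_mul x.1 y.1 γ.unop.1)
  add_smul γ δ x := Subtype.ext (mul_add x.1 γ.unop.1 δ.unop.1)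
  zero_smul x := Subtype.ext (mul_zero x.1)

instance {p : R} (hp : IsIdempotentElem p) : SMulCommClass R hp.Cornerᵐᵒᵖ (leftIdeal p) where
  smul_comm r γ x := Subtype.ext (mul_assoc r x.1 γ.unop.1).symm

variable {e : R}

/-- The ring `Γ_e = (1-e)R(1-e)`, with unit `1-e`. -/
abbrev Gam (he : IsIdempotentElem e) : Type u := he.one_sub.Corner

variable (e) in
/-- The underlying group of `F_e(M) = M ⊗_R R(1-e)`. It is a right `Γ_e`-module. -/
abbrev F (M : Type v) [AddCommGroup M] [Module Rᵐᵒᵖ M] : Type (max v u) :=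
  BalancedTensor R M (leftIdeal (1 - e))

/-- The map `F_e(φ) = φ ⊗ id` of right `Γ_e`-modules. -/
def Fmap (he : IsIdempotentElem e) {M M' : Type*} [AddCommGroup M] [Module Rᵐᵒᵖ M]
    [AddCommGroup M'] [Module Rᵐᵒᵖ M'] (φ : M →ₗ[Rᵐᵒᵖ] M') :
    F e M →ₗ[(Gam he)ᵐᵒᵖ] F e M' where
  toFun := balancedMap R φ LinearMap.id
  map_add' := map_add _
  map_smul' γ x := DFunLike.congr_fun (balancedTensor_hom_ext R
    (f := (balancedMap R φ LinearMap.id).comp (balancedAction R M (leftIdeal (1 - e)) γ))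
    (g := (balancedAction R M' (leftIdeal (1 - e)) γ).comp (balancedMap R φ LinearMap.id))
    fun _ _ => rfl) x

end Functor

/-! ### Projective covers and minimal projective resolutions -/

section Resolution

/-- A submodule `N` of `M` is superfluous (small) if `N + L = M` implies `L = M`. -/
def IsSuperfluous {A : Type*} [Ring A] {M : Type*} [AddCommGroup M] [Module A M]
    (N : Submodule A M) : Prop :=
  ∀ L : Submodule A M, N ⊔ L = ⊤ → L = ⊤

/-- `g : P → K` is a projective cover. -/
structure IsProjectiveCover {A : Type*} [Ring A] {P K : Type*} [AddCommGroup P] [Module A P]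
    [AddCommGroup K] [Module A K] (g : P →ₗ[A] K) : Prop where
  projective : Module.Projective A P
  surjective : Function.Surjective g
  superfluous : IsSuperfluous (LinearMap.ker g)

/-- The augmented complex `⋯ → C 2 → C 1 → C 0 → M → 0` with differentials `d i : C (i+1) → C i`
and augmentation `ε : C 0 → M` is a minimal projective resolution of `M` by finitely generated
projective modules: it is exact, and the maps `C 0 → M` and `C (i+1) → im (d i)` are projective
covers. -/
structure IsMinimalProjectiveResolution {A : Type*} [Ring A] {C : ℕ → Type*}
    [∀ i, AddCommGroup (C i)] [∀ i, Module A (C i)] {M : Type*} [AddCommGroup M] [Module A M]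
    (d : ∀ i, C (i + 1) →ₗ[A] C i) (ε : C 0 →ₗ[A] M) : Prop where
  finite : ∀ i, Module.Finite A (C i)
  exact_zero : Function.Exact (d 0) ε
  exact_succ : ∀ i, Function.Exact (d (i + 1)) (d i)
  cover_zero : IsProjectiveCover ε
  cover_succ : ∀ i, IsProjectiveCover (d i).rangeRestrict

end Resolution

/-! ### Envelopes and the construction -/

section Construction

variable {R : Type u} [Ring R]

/-- `X` lies in the full subcategory `mod R/⟨1-e⟩` of `mod R`: the two-sided ideal generated by
`1-e` annihilates `X`. -/
def InModQuotient (e : R) (X : FGModuleCat.{u} Rᵐᵒᵖ) : Prop :=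
  ∀ r ∈ TwoSidedIdeal.span {1 - e}, ∀ x : X, MulOpposite.op r • x = 0

/-- `f : Ω → X` is a `mod R/⟨1-e⟩`-envelope of `Ω`. -/
structure IsEnvelope (e : R) {Ω X : FGModuleCat.{u} Rᵐᵒᵖ} (f : Ω →ₗ[Rᵐᵒᵖ] X) : Prop where
  mem : InModQuotient e X
  preenvelope : ∀ X' : FGModuleCat.{u} Rᵐᵒᵖ, InModQuotient e X' →
    ∀ φ : Ω →ₗ[Rᵐᵒᵖ] X', ∃ ψ : X →ₗ[Rᵐᵒᵖ] X', ψ ∘ₗ f = φ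
  minimal : ∀ g : X →ₗ[Rᵐᵒᵖ] X, g ∘ₗ f = f → Function.Bijective g

/-- `k : K → M` is a kernel of `f : M → N`. -/
structure IsKernel {A : Type*} [Ring A] {K M N : Type*} [AddCommGroup K] [Module A K]
    [AddCommGroup M] [Module A M] [AddCommGroup N] [Module A N]
    (k : K →ₗ[A] M) (f : M →ₗ[A] N) : Prop where
  injective : Function.Injective k
  range_eq : LinearMap.range k = LinearMap.ker f

/-- The data obtained by running the construction: starting with `Ω 0`, for all `i`,
`f i : Ω i → X i` is a `mod R/⟨1-e⟩`-envelope with kernel `k i : K i → Ω i`, and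
`g i : P i → K i` is a projective cover with kernel `h i : Ω (i+1) → P i`. -/
structure Construction (e : R) where
  Ω : ℕ → FGModuleCat.{u} Rᵐᵒᵖ
  X : ℕ → FGModuleCat.{u} Rᵐᵒᵖ
  K : ℕ → FGModuleCat.{u} Rᵐᵒᵖ
  P : ℕ → FGModuleCat.{u} Rᵐᵒᵖ
  f : ∀ i, Ω i →ₗ[Rᵐᵒᵖ] X i
  k : ∀ i, K i →ₗ[Rᵐᵒᵖ] Ω i
  g : ∀ i, P i →ₗ[Rᵐᵒᵖ] K i
  h : ∀ i, Ω (i + 1) →ₗ[Rᵐᵒᵖ] P i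
  envelope : ∀ i, IsEnvelope e (f i)
  kernel_envelope : ∀ i, IsKernel (k i) (f i)
  cover : ∀ i, IsProjectiveCover (g i)
  kernel_cover : ∀ i, IsKernel (h i) (g i)

namespace Construction

variable {e : R} (D : Construction e)

/-- The composite `P (i+1) → K (i+1) → Ω (i+1) → P i`. -/
def d (i : ℕ) : D.P (i + 1) →ₗ[Rᵐᵒᵖ] D.P i := D.h i ∘ₗ D.k (i + 1) ∘ₗ D.g (i + 1)

/-- The composite `P 0 → K 0 → Ω 0`. -/
def aug : D.P 0 →ₗ[Rᵐᵒᵖ] D.Ω 0 := D.k 0 ∘ₗ D.g 0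

end Construction

end Construction

end IdempotentReduction

/-! Put p = 1-e. The map m ⊗ x ↦ mx identifies F_e(M) with Mp (`pureTensor_evalF`, `op_smul_evalF`,
`exists_evalF_eq`), so questions about F_e become questions about elements fixed by p.

Every envelope of Ω has kernel ΩpR, the submodule generated by Ωp (`IsEnvelope.ker_eq`). Hence K_i
is generated by K_i p, and K_i p maps onto Ω_i p. Generation by the p-part passes to the projective
cover P_i, since the kernel of g_i is superfluous. For P generated by Pp, two things hold: if P is
also finitely generated projective, then Pp is finitely generated projective over Γ_e
(`finite_projective_F`); and F_e preserves superfluous kernels, because a Γ_e-submodule L of Pp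
satisfies (LR)p = L (`IsSuperfluous.ker_Fmap`). Exactness holds because the p-part of ker g_i is
Ω_{i+1}p, which P_{i+1}p covers.

The choices exist because right noetherianity keeps kernels finitely generated and semiperfectness
gives projective covers of right modules; these are lifted from the semisimple quotient by lifting
idempotents. -/

namespace IdempotentReduction

open MulOpposite

/-! ### Existence of projective covers over semiperfect rings -/

section ProjectiveCover

variable {S : Type u} [Ring S]

/-- A submodule contained in the Jacobson radical of a finitely generated module is superfluous. -/
theorem isSuperfluous_of_le_jacobson {P : Type v} [AddCommGroup P] [Module S P]
    [Module.Finite S P] {N : Submodule S P} (hN : N ≤ Module.jacobson S P) :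
    IsSuperfluous N := by
  intro L hL
  obtain h | ⟨m, hm, hLm⟩ := eq_top_or_exists_le_coatom L
  · exact h
  · exact absurd (eq_top_iff.mpr (hL ▸ sup_le (hN.trans (sInf_le hm)) hLm)) hm.1

/-- Being the image of a finitely generated projective `S`-module `P` under a semilinear map whose
kernel is contained in `I P`. -/
def HasCoverModulo (I : Ideal S) [I.IsTwoSided] (N : Type v) [AddCommGroup N]
    [Module (S ⧸ I) N] : Prop :=
  ∃ (P : Type u) (_ : AddCommGroup P) (_ : Module S P) (q : P →ₛₗ[Ideal.Quotient.mk I] N),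
    Module.Finite S P ∧ Module.Projective S P ∧ Function.Surjective q ∧
      LinearMap.ker q ≤ I • (⊤ : Submodule S P)

variable {I : Ideal S} [I.IsTwoSided]

theorem HasCoverModulo.of_equiv {N : Type v} {N' : Type w} [AddCommGroup N] [Module (S ⧸ I) N]
    [AddCommGroup N'] [Module (S ⧸ I) N'] (h : HasCoverModulo I N) (φ : N ≃ₗ[S ⧸ I] N') :
    HasCoverModulo I N' := by
  obtain ⟨P, _, _, q, hf, hp, hs, hk⟩ := h
  refine ⟨P, _, _, φ.toLinearMap.comp q, hf, hp, φ.surjective.comp hs, fun x hx => hk ?_⟩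
  exact φ.map_eq_zero_iff.mp hx

theorem HasCoverModulo.pi {ι : Type} [Fintype ι] [DecidableEq ι] {N : ι → Type v}
    [∀ i, AddCommGroup (N i)] [∀ i, Module (S ⧸ I) (N i)] (h : ∀ i, HasCoverModulo I (N i)) :
    HasCoverModulo I (∀ i, N i) := by
  choose P _ _ q hf hp hs hk using h
  refine ⟨∀ i, P i, inferInstance, inferInstance,
    { toFun := fun x i => q i (x i)
      map_add' := fun x y => funext fun i => map_add (q i) _ _
      map_smul' := fun r x => funext fun i => map_smulₛₗ (q i) _ _ },
    inferInstance, ?_, fun y => ?_, fun x hx => ?_⟩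
  · exact Module.Projective.of_equiv (DFinsupp.linearEquivFunOnFintype (R := S) (M := P))
  · choose x hx using fun i => hs i (y i)
    exact ⟨x, funext hx⟩
  · rw [← Finset.univ_sum_single x]
    refine Submodule.sum_mem _ fun i _ => ?_
    have h1 : x i ∈ I • (⊤ : Submodule S (P i)) := hk i (congrFun hx i)
    have h2 := Submodule.mem_map_of_mem (f := LinearMap.single S P i) h1
    rw [Submodule.map_smul''] at h2
    exact Submodule.smul_mono le_rfl le_top h2

/-- Lift x to an idempotent r. Then Sr is a direct summand of S, and since y = yr on Sr, any y in Sr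
∩ I already lies in I·Sr. -/
theorem HasCoverModulo.ideal
    (hlift : ∀ x : S ⧸ I, IsIdempotentElem x →
      ∃ r : S, IsIdempotentElem r ∧ Ideal.Quotient.mk I r = x)
    {x : S ⧸ I} (hx : IsIdempotentElem x) :
    HasCoverModulo I (Ideal.span {x}) := by
  obtain ⟨r, hr, rfl⟩ := hlift x hx
  have hmul : ∀ y ∈ Ideal.span {r}, y * r = y := fun y hy => by
    obtain ⟨a, rfl⟩ := Ideal.mem_span_singleton'.mp hy
    rw [mul_assoc, hr.eq]
  have hrmem : r ∈ Ideal.span {r} := Ideal.mem_span_singleton_self r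
  let q : (Ideal.span {r} : Ideal S) →ₛₗ[Ideal.Quotient.mk I]
      (Ideal.span {Ideal.Quotient.mk I r} : Ideal (S ⧸ I)) :=
    { toFun := fun y => ⟨Ideal.Quotient.mk I y.1, by
        rw [← hmul y.1 y.2, map_mul]
        exact Ideal.mul_mem_left _ _ (Ideal.mem_span_singleton_self _)⟩
      map_add' := fun _ _ => rfl
      map_smul' := fun _ _ => rfl }
  refine ⟨(Ideal.span {r} : Ideal S), inferInstance, inferInstance, q, ?_, ?_, ?_, ?_⟩
  · exact Module.Finite.of_fg ⟨{r}, by simp [Ideal.span]⟩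
  · refine Module.Projective.of_split (M := S) (Submodule.subtype _)
      (LinearMap.toSpanSingleton S _ ⟨r, hrmem⟩) ?_
    ext y
    exact hmul y.1 y.2
  · rintro ⟨y, hy⟩
    obtain ⟨a, rfl⟩ := Ideal.mem_span_singleton'.mp hy
    obtain ⟨b, rfl⟩ := Ideal.Quotient.mk_surjective a
    exact ⟨⟨b * r, Ideal.mul_mem_left _ _ hrmem⟩, rfl⟩
  · intro y hy
    have h1 : y.1 ∈ I := Ideal.Quotient.eq_zero_iff_mem.mp (congrArg Subtype.val hy)
    have h2 : y = y.1 • (⟨r, hrmem⟩ : (Ideal.span {r} : Ideal S)) :=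
      Subtype.ext (hmul y.1 y.2).symm
    rw [h2]
    exact Submodule.smul_mem_smul h1 trivial

/-- A finitely generated semisimple module is a finite direct sum of simple modules, each isomorphic
to a left ideal generated by an idempotent. -/
theorem HasCoverModulo.of_finite [IsSemisimpleRing (S ⧸ I)]
    (hlift : ∀ x : S ⧸ I, IsIdempotentElem x →
      ∃ r : S, IsIdempotentElem r ∧ Ideal.Quotient.mk I r = x)
    (N : Type v) [AddCommGroup N] [Module (S ⧸ I) N] [Module.Finite (S ⧸ I) N] :
    HasCoverModulo I N := by
  obtain ⟨n, T, φ, hT⟩ := IsSemisimpleModule.exists_linearEquiv_fin_dfinsupp (S ⧸ I) N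
  have h : ∀ i, HasCoverModulo I (T i) := fun i => by
    have := hT i
    obtain ⟨L, ⟨ψ⟩⟩ := IsSemisimpleRing.exists_linearEquiv_ideal_of_isSimpleModule (S ⧸ I) (T i)
    obtain ⟨x, hx, rfl⟩ := IsSemisimpleRing.ideal_eq_span_idempotent L
    exact (HasCoverModulo.ideal hlift hx).of_equiv ψ.symm
  exact (HasCoverModulo.pi h).of_equiv
    ((DFinsupp.linearEquivFunOnFintype (R := S ⧸ I)).symm.trans φ.symm)

/-- If `I` is contained in the Jacobson radical, `S / I` is semisimple and idempotents lift modulo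
`I`, then every finitely generated module has a projective cover. -/
theorem exists_isProjectiveCover [IsSemisimpleRing (S ⧸ I)] (hI : I ≤ Ring.jacobson S)
    (hlift : ∀ x : S ⧸ I, IsIdempotentElem x →
      ∃ r : S, IsIdempotentElem r ∧ Ideal.Quotient.mk I r = x)
    (M : Type v) [AddCommGroup M] [Module S M] [Module.Finite S M] :
    ∃ (P : Type u) (_ : AddCommGroup P) (_ : Module S P) (g : P →ₗ[S] M),
      Module.Finite S P ∧ IsProjectiveCover g := by
  have : Module.Finite (S ⧸ I) (M ⧸ I • (⊤ : Submodule S M)) :=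
    Module.Finite.of_restrictScalars_finite S _ _
  obtain ⟨P, _, _, q, hf, hp, hs, hk⟩ :=
    HasCoverModulo.of_finite hlift (M ⧸ I • (⊤ : Submodule S M))
  let q' : P →ₗ[S] M ⧸ I • (⊤ : Submodule S M) :=
    { toFun := q, map_add' := q.map_add, map_smul' := fun r x => q.map_smulₛₗ r x }
  obtain ⟨g, hg⟩ := Module.projective_lifting_property (I • (⊤ : Submodule S M)).mkQ q'
    (Submodule.mkQ_surjective _)
  have hgq : ∀ x, Submodule.Quotient.mk (g x) = q x := fun x => DFunLike.congr_fun hg x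
  refine ⟨P, _, _, g, hf, hp, ?_, ?_⟩
  -- Nakayama: `g` is onto modulo IM, and IM is superfluous in M.
  · refine LinearMap.range_eq_top.mp (isSuperfluous_of_le_jacobson
      ((Submodule.smul_mono_left hI).trans (Ring.jacobson_smul_top_le S M)) _
      (eq_top_iff.mpr fun m _ => ?_))
    obtain ⟨x, hx⟩ := hs (Submodule.Quotient.mk m)
    rw [← hgq, Submodule.Quotient.eq] at hx
    refine Submodule.mem_sup.mpr ⟨m - g x, ?_, g x, ⟨x, rfl⟩, sub_add_cancel _ _⟩
    rw [← neg_sub]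
    exact Submodule.neg_mem _ hx
  · refine isSuperfluous_of_le_jacobson (le_trans (fun x hx => hk ?_)
      ((Submodule.smul_mono_left hI).trans (Ring.jacobson_smul_top_le S P)))
    rw [LinearMap.mem_ker] at hx ⊢
    rw [← hgq, hx, Submodule.Quotient.mk_zero]

/-- Left-right symmetry of the radical: a left inverse z of 1 + c, with c in the radical, equals 1 -
zc and so has a left inverse itself. Thus z is a two-sided inverse. -/
theorem op_mem_jacobson {R : Type u} [Ring R] {a : R} (ha : a ∈ Ring.jacobson R) :
    op a ∈ Ring.jacobson Rᵐᵒᵖ := by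
  have key : ∀ c ∈ Ring.jacobson R, ∃ z, z * (1 + c) = 1 := fun c hc => by
    rw [← Ideal.jacobson_bot, Ideal.mem_jacobson_iff] at hc
    obtain ⟨z, hz⟩ := hc 1
    refine ⟨z, ?_⟩
    rw [Submodule.mem_bot, mul_one, sub_eq_zero] at hz
    rw [mul_add, mul_one, add_comm, hz]
  rw [← Ideal.jacobson_bot, Ideal.mem_jacobson_iff]
  intro y
  have hc : a * y.unop ∈ Ring.jacobson R := Ideal.mul_mem_right _ _ ha
  obtain ⟨z, hz⟩ := key _ hc
  obtain ⟨t, ht⟩ := key (-(z * (a * y.unop)))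
    (Submodule.neg_mem _ (Ideal.mul_mem_left _ _ hc))
  have hz' : 1 + -(z * (a * y.unop)) = z := by
    rw [← hz]; noncomm_ring
  rw [hz'] at ht
  have hzt : (1 + a * y.unop) * z = 1 := left_inv_eq_right_inv ht hz ▸ ht
  refine ⟨op z, ?_⟩
  rw [Submodule.mem_bot, sub_eq_zero]
  apply unop_injective
  simp only [unop_add, unop_mul, unop_op, unop_one]
  rw [← hzt]
  noncomm_ring

/-- Finitely generated right modules over a semiperfect ring have projective covers. -/
theorem IsSemiperfect.exists_isProjectiveCover {R : Type u} [Ring R] (hR : IsSemiperfect R)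
    (M : Type v) [AddCommGroup M] [Module Rᵐᵒᵖ M] [Module.Finite Rᵐᵒᵖ M] :
    ∃ (P : Type u) (_ : AddCommGroup P) (_ : Module Rᵐᵒᵖ P) (g : P →ₗ[Rᵐᵒᵖ] M),
      Module.Finite Rᵐᵒᵖ P ∧ IsProjectiveCover g := by
  -- The kernel of `π` is rad R seen in the opposite ring; only its inclusion in the radical of
  -- `Rᵐᵒᵖ` is needed.
  let π : Rᵐᵒᵖ →+* (R ⧸ Ring.jacobson R)ᵐᵒᵖ := RingHom.op (Ideal.Quotient.mk (Ring.jacobson R))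
  have hπ : Function.Surjective π := fun y => by
    obtain ⟨r, hr⟩ := Ideal.Quotient.mk_surjective y.unop
    exact ⟨op r, unop_injective hr⟩
  let φ : Rᵐᵒᵖ ⧸ RingHom.ker π ≃+* (R ⧸ Ring.jacobson R)ᵐᵒᵖ :=
    RingHom.quotientKerEquivOfSurjective hπ
  have := hR.semisimple
  have : IsSemisimpleRing (Rᵐᵒᵖ ⧸ RingHom.ker π) := φ.symm.isSemisimpleRing
  refine IdempotentReduction.exists_isProjectiveCover (I := RingHom.ker π) (fun x hx => ?_)
    (fun x hx => ?_) M
  · exact op_mem_jacobson (Ideal.Quotient.eq_zero_iff_mem.mp (op_injective hx))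
  · have hx' : IsIdempotentElem (φ x).unop := by
      rw [IsIdempotentElem, ← unop_mul, ← map_mul, hx.eq]
    obtain ⟨r, hr, hrx⟩ := hR.lift_idempotent _ hx'
    refine ⟨op r, ?_, φ.injective (unop_injective hrx)⟩
    rw [IsIdempotentElem, ← op_mul, hr.eq]

end ProjectiveCover

end IdempotentReduction
namespace IdempotentReduction

open MulOpposite TensorProduct

/-! ### Identification of F_e(M) with M(1-e) -/

section Evaluation

variable {R : Type u} [Ring R] {e : R} {M : Type v} [AddCommGroup M] [Module Rᵐᵒᵖ M]
  {M' : Type w} [AddCommGroup M'] [Module Rᵐᵒᵖ M']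

/-- The element `1 - e` of `R(1-e)`. -/
def leftIdealGen (e : R) : leftIdeal (1 - e) :=
  ⟨1 - e, Submodule.mem_span_singleton_self _⟩

theorem mul_of_mem_leftIdeal (he : IsIdempotentElem e) (x : leftIdeal (1 - e)) :
    x.1 * (1 - e) = x.1 := by
  obtain ⟨a, ha⟩ := Submodule.mem_span_singleton.mp x.2
  rw [← ha, smul_eq_mul, mul_assoc, he.one_sub.eq]

theorem pureTensor_smul (m : M) (r : R) {N : Type w} [AddCommGroup N] [Module R N] (n : N) :
    pureTensor R (op r • m) n = pureTensor R m (r • n) := by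
  refine (QuotientAddGroup.eq_iff_sub_mem).mpr ?_
  exact AddSubgroup.subset_closure ⟨m, r, n, rfl⟩

variable (e M) in
/-- The map `m ⊗ x ↦ m x` from `F_e(M) = M ⊗ R(1-e)` to `M`. -/
def evalF : F e M →+ M :=
  QuotientAddGroup.lift (balancedRel R M (leftIdeal (1 - e)))
    (TensorProduct.liftAddHom
      (AddMonoidHom.mk' (fun m : M => AddMonoidHom.mk'
          (fun x : leftIdeal (1 - e) => op x.1 • m)
          fun x y => add_smul (op x.1) (op y.1) m)
        fun m n => AddMonoidHom.ext fun x => smul_add (op x.1) m n)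
      fun z m x => by
        rw [map_zsmul, map_zsmul]; rfl) (by
    rw [balancedRel, AddSubgroup.closure_le]
    rintro _ ⟨m, r, x, rfl⟩
    rw [SetLike.mem_coe, AddMonoidHom.mem_ker, map_sub, sub_eq_zero]
    exact smul_smul (op x.1) (op r) m)

theorem evalF_pureTensor (m : M) (x : leftIdeal (1 - e)) :
    evalF e M (pureTensor R m x) = op x.1 • m := rfl

/-- With p = 1-e, each x in Rp satisfies x = xp, so m ⊗ x = m ⊗ xp = mx ⊗ p. -/
theorem pureTensor_evalF (he : IsIdempotentElem e) (z : F e M) :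
    pureTensor R (evalF e M z) (leftIdealGen e) = z := by
  let φ : M →+ F e M := AddMonoidHom.mk' (fun m => pureTensor R m (leftIdealGen e)) fun m n =>
    (congrArg (QuotientAddGroup.mk' (balancedRel R M (leftIdeal (1 - e))))
      (TensorProduct.add_tmul m n _)).trans (map_add _ _ _)
  refine DFunLike.congr_fun (balancedTensor_hom_ext R (f := φ.comp (evalF e M))
    (g := AddMonoidHom.id _) fun m x => ?_) z
  refine (pureTensor_smul m x.1 (leftIdealGen e)).trans (congrArg _ (Subtype.ext ?_))
  exact mul_of_mem_leftIdeal he x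

theorem evalF_injective (he : IsIdempotentElem e) : Function.Injective (evalF e M) :=
  (Function.LeftInverse.injective (g := fun m => pureTensor R m (leftIdealGen e))
    (pureTensor_evalF he))

theorem op_smul_evalF (he : IsIdempotentElem e) (z : F e M) :
    op (1 - e) • evalF e M z = evalF e M z := by
  conv_lhs => rw [← pureTensor_evalF he z, evalF_pureTensor]
  conv_rhs => rw [← pureTensor_evalF he z, evalF_pureTensor]
  change op (1 - e) • op (1 - e) • evalF e M z = op (1 - e) • evalF e M z
  rw [smul_smul, ← op_mul, he.one_sub.eq]

theorem exists_evalF_eq {m : M} (hm : op (1 - e) • m = m) : ∃ z, evalF e M z = m :=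
  ⟨pureTensor R m (leftIdealGen e), hm⟩

theorem evalF_smul (he : IsIdempotentElem e) (γ : (Gam he)ᵐᵒᵖ) (z : F e M) :
    evalF e M (γ • z) = op γ.unop.1 • evalF e M z :=
  DFunLike.congr_fun (balancedTensor_hom_ext R
    (f := (evalF e M).comp (balancedAction R M (leftIdeal (1 - e)) γ))
    (g := (DistribSMul.toAddMonoidHom M (op γ.unop.1)).comp (evalF e M))
    fun m x => (smul_smul (op γ.unop.1) (op x.1) m).symm) z

theorem evalF_Fmap (he : IsIdempotentElem e) (φ : M →ₗ[Rᵐᵒᵖ] M') (z : F e M) :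
    evalF e M' (Fmap he φ z) = φ (evalF e M z) :=
  DFunLike.congr_fun (balancedTensor_hom_ext R
    (f := (evalF e M').comp (balancedMap R φ LinearMap.id))
    (g := φ.toAddMonoidHom.comp (evalF e M))
    fun m x => (φ.map_smul (op x.1) m).symm) z

theorem Fmap_eq_zero_iff (he : IsIdempotentElem e) (φ : M →ₗ[Rᵐᵒᵖ] M') (z : F e M) :
    Fmap he φ z = 0 ↔ φ (evalF e M z) = 0 := by
  rw [← evalF_Fmap he, map_eq_zero_iff _ (evalF_injective he)]

end Evaluation

/-! ### Modules generated by M(1-e) -/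

section Generation

variable {R : Type u} [Ring R] {e : R} {M : Type v} [AddCommGroup M] [Module Rᵐᵒᵖ M]
  {M' : Type w} [AddCommGroup M'] [Module Rᵐᵒᵖ M']

variable (e M) in
/-- The submodule `M⟨1-e⟩ = M(1-e)R` of `M`. -/
def traceSubmodule : Submodule Rᵐᵒᵖ M :=
  Submodule.span Rᵐᵒᵖ {m | op (1 - e) • m = m}

theorem op_smul_mem_traceSubmodule (he : IsIdempotentElem e) (m : M) :
    op (1 - e) • m ∈ traceSubmodule e M :=
  Submodule.subset_span (by rw [Set.mem_ofPred, smul_smul, ← op_mul, he.one_sub.eq])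

theorem op_smul_mem_traceSubmodule_of_mem_span (he : IsIdempotentElem e) {r : R}
    (hr : r ∈ TwoSidedIdeal.span {1 - e}) (m : M) : op r • m ∈ traceSubmodule e M := by
  -- The elements acting as zero on the quotient are the kernel of a ring homomorphism, hence a
  -- two-sided ideal, so it suffices to treat 1-e. The target is opposite because the action is on
  -- the right.
  let ρ : R →+* (AddMonoid.End (M ⧸ traceSubmodule e M))ᵐᵒᵖ :=
    RingHom.unop ((RingEquiv.opOp _).toRingHom.comp
      (Module.toAddMonoidEnd Rᵐᵒᵖ (M ⧸ traceSubmodule e M)))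
  have h : r ∈ TwoSidedIdeal.ker ρ := TwoSidedIdeal.mem_span_iff.mp hr _ (by
    rintro _ rfl
    rw [SetLike.mem_coe, TwoSidedIdeal.mem_ker]
    apply unop_injective
    ext x
    obtain ⟨m, rfl⟩ := Submodule.Quotient.mk_surjective _ x
    exact (Submodule.Quotient.mk_eq_zero _).mpr (op_smul_mem_traceSubmodule he m))
  rw [TwoSidedIdeal.mem_ker] at h
  exact (Submodule.Quotient.mk_eq_zero _).mp
    (DFunLike.congr_fun (congrArg unop h) (Submodule.Quotient.mk m))

/-- A projective cover of a module generated by `K(1-e)` is generated by `P(1-e)`. -/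
theorem IsProjectiveCover.traceSubmodule_eq_top (he : IsIdempotentElem e) {g : M →ₗ[Rᵐᵒᵖ] M'}
    (hg : IsProjectiveCover g) (h : traceSubmodule e M' = ⊤) : traceSubmodule e M = ⊤ := by
  refine hg.superfluous _ (eq_top_iff.mpr ?_)
  -- If y = g(x) is fixed by p = 1-e, then y = g(xp). So the trace of M maps onto M', and together
  -- with the kernel of `g` it fills M.
  have hmap : (traceSubmodule e M).map g = ⊤ := by
    refine top_le_iff.mp (h.symm.le.trans (Submodule.span_le.mpr fun y hy => ?_))
    obtain ⟨x, rfl⟩ := hg.surjective y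
    exact ⟨op (1 - e) • x, op_smul_mem_traceSubmodule he x, by rw [map_smul]; exact hy⟩
  intro x _
  obtain ⟨y, hy, hxy⟩ : g x ∈ (traceSubmodule e M).map g := hmap ▸ trivial
  exact Submodule.mem_sup.mpr ⟨x - y, by rw [LinearMap.mem_ker, map_sub, hxy, sub_self], y, hy,
    sub_add_cancel _ _⟩

/-- If `M` is generated by `M(1-e)`, then `F_e` preserves superfluous kernels. -/
theorem IsSuperfluous.ker_Fmap (he : IsIdempotentElem e) {φ : M →ₗ[Rᵐᵒᵖ] M'}
    (hφ : IsSuperfluous (LinearMap.ker φ)) (hM : traceSubmodule e M = ⊤) :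
    IsSuperfluous (LinearMap.ker (Fmap he φ)) := by
  intro L hL
  let L' : Submodule Rᵐᵒᵖ M := Submodule.span Rᵐᵒᵖ (evalF e M '' L)
  have h : L' = ⊤ := by
    refine hφ L' (top_le_iff.mp (hM.symm.le.trans (Submodule.span_le.mpr fun m hm => ?_)))
    obtain ⟨z, rfl⟩ := exists_evalF_eq hm
    obtain ⟨a, ha, b, hb, rfl⟩ := Submodule.mem_sup.mp (hL.symm.le (Submodule.mem_top (x := z)))
    rw [map_add]
    exact Submodule.add_mem_sup ((Fmap_eq_zero_iff he φ a).mp ha)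
      (Submodule.subset_span ⟨b, hb, rfl⟩)
  -- This is (LR)p ⊆ L, with p = 1-e: for z in L one has z = zp, so z(rp) = z(prp) with prp in Γ_e.
  have key : ∀ m ∈ L', ∃ z ∈ L, evalF e M z = op (1 - e) • m := fun m hm => by
    induction hm using Submodule.closure_induction with
    | zero => exact ⟨0, L.zero_mem, by rw [map_zero, smul_zero]⟩
    | add x y _ _ hx hy =>
      obtain ⟨a, ha, hax⟩ := hx
      obtain ⟨b, hb, hby⟩ := hy
      exact ⟨a + b, L.add_mem ha hb, by rw [map_add, hax, hby, smul_add]⟩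
    | smul_mem r x hx =>
      obtain ⟨z, hz, rfl⟩ := hx
      let γ : Gam he := ⟨(1 - e) * r.unop * (1 - e), r.unop, rfl⟩
      refine ⟨op γ • z, L.smul_mem _ hz, ?_⟩
      rw [evalF_smul]
      conv_rhs => rw [← op_smul_evalF he z]
      rw [smul_smul, smul_smul]
      exact congrArg (· • evalF e M z) (unop_injective (mul_assoc _ _ _))
  refine eq_top_iff.mpr fun z _ => ?_
  obtain ⟨y, hy, hyz⟩ := key (evalF e M z) (h ▸ trivial)
  rw [op_smul_evalF he] at hyz
  rwa [← evalF_injective he hyz]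

theorem exists_finset_of_traceSubmodule_eq_top [Module.Finite Rᵐᵒᵖ M]
    (hM : traceSubmodule e M = ⊤) :
    ∃ (n : ℕ) (z : Fin n → F e M),
      Submodule.span Rᵐᵒᵖ (Set.range fun i => evalF e M (z i)) = ⊤ := by
  have hfg : (traceSubmodule e M).FG := hM ▸ Module.Finite.fg_top
  obtain ⟨s, hs, hspan⟩ := (Submodule.fg_span_iff_fg_span_finset_subset _).mp hfg
  choose z hz using fun x : s => exists_evalF_eq (e := e) (hs x.2)
  refine ⟨s.card, fun i => z (s.equivFin.symm i), ?_⟩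
  rw [← hM, traceSubmodule, hspan]
  congr 1
  ext x
  constructor
  · rintro ⟨i, rfl⟩
    change evalF e M (z _) ∈ _
    rw [hz]
    exact (s.equivFin.symm i).2
  · intro hx
    exact ⟨s.equivFin ⟨x, hx⟩, by simp [hz]⟩

/-- If a finitely generated projective module `M` is generated by `M(1-e)`, then `F_e(M)` is a
finitely generated projective `Γ_e`-module. -/
theorem finite_projective_F (he : IsIdempotentElem e) [Module.Finite Rᵐᵒᵖ M]
    [Module.Projective Rᵐᵒᵖ M] (hM : traceSubmodule e M = ⊤) :
    Module.Finite (Gam he)ᵐᵒᵖ (F e M) ∧ Module.Projective (Gam he)ᵐᵒᵖ (F e M) := by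
  obtain ⟨n, z, hz⟩ := exists_finset_of_traceSubmodule_eq_top hM
  obtain ⟨s, hs⟩ := Module.projective_lifting_property
    (Fintype.linearCombination Rᵐᵒᵖ fun i => evalF e M (z i)) LinearMap.id
    (by rw [← LinearMap.range_eq_top, Fintype.range_linearCombination, hz])
  have hs' : ∀ m, ∑ i, s m i • evalF e M (z i) = m := fun m => DFunLike.congr_fun hs m
  let p : R := 1 - e
  -- Compress the coordinates of the splitting `s` to p s_i p in Γ_e. This still splits: for x in
  -- Mp, the sum of the z_i p s_i p is (∑ z_i s_i)p = xp = x.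
  let σ : F e M →ₗ[(Gam he)ᵐᵒᵖ] (Fin n → (Gam he)ᵐᵒᵖ) :=
    { toFun := fun x i => op ⟨p * (s (evalF e M x) i).unop * p, _, rfl⟩
      map_add' := fun x y => funext fun i => unop_injective (Subtype.ext (by
        change p * (s (evalF e M (x + y)) i).unop * p =
          p * (s (evalF e M x) i).unop * p + p * (s (evalF e M y) i).unop * p
        rw [map_add, map_add, Pi.add_apply, unop_add, mul_add, add_mul]))
      map_smul' := fun γ x => funext fun i => unop_injective (Subtype.ext (by
        obtain ⟨h1, h2⟩ := (Subsemigroup.mem_corner_iff he.one_sub).mp γ.unop.2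
        change p * (s (evalF e M (γ • x)) i).unop * p =
          p * (s (evalF e M x) i).unop * p * γ.unop.1
        rw [evalF_smul, map_smul, Pi.smul_apply, smul_eq_mul, unop_mul, unop_op]
        simp only [mul_assoc]
        rw [h1, h2])) }
  have hσ : Fintype.linearCombination (Gam he)ᵐᵒᵖ z ∘ₗ σ = LinearMap.id := by
    ext x
    apply evalF_injective he
    change evalF e M (∑ i, σ x i • z i) = evalF e M x
    rw [map_sum]
    calc ∑ i, evalF e M (σ x i • z i)
        = ∑ i, op p • s (evalF e M x) i • evalF e M (z i) := by
          refine Finset.sum_congr rfl fun i _ => ?_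
          rw [evalF_smul]
          conv_rhs => rw [← op_smul_evalF he (z i)]
          rw [smul_smul, smul_smul]
          exact congrArg (· • evalF e M (z i)) (unop_injective (mul_assoc _ _ _))
      _ = evalF e M x := by rw [← Finset.smul_sum, hs', op_smul_evalF he]
  refine ⟨Module.Finite.of_surjective (Fintype.linearCombination (Gam he)ᵐᵒᵖ z)
    fun x => ⟨σ x, DFunLike.congr_fun hσ x⟩, Module.Projective.of_split σ _ hσ⟩

end Generation

end IdempotentReduction
namespace IdempotentReduction

open MulOpposite

/-! ### Envelopes and their kernels -/

section Envelope

variable {R : Type u} [Ring R] {e : R}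

/-- A map to a module killed by 1-e kills Ω(1-e) and the submodule it generates. Minimality is
automatic: the quotient map is onto, so only the identity fixes it. -/
theorem isEnvelope_mkQ (he : IsIdempotentElem e) (Ω : FGModuleCat.{u} Rᵐᵒᵖ) :
    IsEnvelope e (X := FGModuleCat.of Rᵐᵒᵖ (Ω ⧸ traceSubmodule e Ω)) (traceSubmodule e Ω).mkQ where
  mem r hr x := by
    obtain ⟨m, rfl⟩ := Submodule.Quotient.mk_surjective _ x
    exact (Submodule.Quotient.mk_eq_zero _).mpr (op_smul_mem_traceSubmodule_of_mem_span he hr m)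
  preenvelope X' hX' φ := by
    refine ⟨(traceSubmodule e Ω).liftQ φ (Submodule.span_le.mpr fun m hm => ?_),
      Submodule.liftQ_mkQ _ _ _⟩
    have hm' : op (1 - e) • m = m := hm
    rw [SetLike.mem_coe, LinearMap.mem_ker, ← hm', map_smul]
    exact hX' _ (TwoSidedIdeal.subset_span rfl) _
  minimal g hg := by
    have : g = LinearMap.id := LinearMap.ext fun x => by
      obtain ⟨m, rfl⟩ := Submodule.Quotient.mk_surjective _ x
      exact DFunLike.congr_fun hg m
    rw [this]
    exact Function.bijective_id

/-- The quotient by the trace is an admissible target, so its projection factors through `f`, which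
bounds the kernel above. The other inclusion holds because 1-e annihilates X. This makes the theorem
valid for every choice of envelopes. -/
theorem IsEnvelope.ker_eq (he : IsIdempotentElem e) {Ω X : FGModuleCat.{u} Rᵐᵒᵖ}
    {f : Ω →ₗ[Rᵐᵒᵖ] X} (hf : IsEnvelope e f) : LinearMap.ker f = traceSubmodule e Ω := by
  apply le_antisymm
  · intro m hm
    obtain ⟨ψ, hψ⟩ := hf.preenvelope _ (isEnvelope_mkQ he Ω).mem (traceSubmodule e Ω).mkQ
    refine (Submodule.Quotient.mk_eq_zero _).mp ((DFunLike.congr_fun hψ m).symm.trans ?_)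
    rw [LinearMap.comp_apply, LinearMap.mem_ker.mp hm, map_zero]
  · refine Submodule.span_le.mpr fun m hm => ?_
    have hm' : op (1 - e) • m = m := hm
    rw [SetLike.mem_coe, LinearMap.mem_ker, ← hm', map_smul]
    exact hf.mem _ (TwoSidedIdeal.subset_span rfl) _

/-- The trace is its own trace: the generators of the trace of M, being fixed by 1-e, come from
elements of K that are fixed as well, by injectivity of `k`. -/
theorem traceSubmodule_eq_top_of_range_eq {K : Type v} [AddCommGroup K] [Module Rᵐᵒᵖ K]
    {M : Type w} [AddCommGroup M] [Module Rᵐᵒᵖ M] {k : K →ₗ[Rᵐᵒᵖ] M}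
    (hk : Function.Injective k) (h : LinearMap.range k = traceSubmodule e M) :
    traceSubmodule e K = ⊤ := by
  have hmap : traceSubmodule e M ≤ (traceSubmodule e K).map k := by
    refine Submodule.span_le.mpr fun m hm => ?_
    obtain ⟨x, rfl⟩ := h.ge (Submodule.subset_span hm)
    exact ⟨x, Submodule.subset_span (hk ((map_smul k _ _).trans hm)), rfl⟩
  refine eq_top_iff.mpr fun x _ => ?_
  obtain ⟨y, hy, hyx⟩ := hmap (h.le ⟨x, rfl⟩)
  exact hk hyx ▸ hy

end Envelope

/-! ### Existence of the inductive choices -/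

section Existence

variable {R : Type u} [Ring R]

/-- One step of the construction, starting from `Ω`. -/
structure ConstructionStep (e : R) (Ω : FGModuleCat.{u} Rᵐᵒᵖ) where
  X : FGModuleCat.{u} Rᵐᵒᵖ
  K : FGModuleCat.{u} Rᵐᵒᵖ
  P : FGModuleCat.{u} Rᵐᵒᵖ
  Ω' : FGModuleCat.{u} Rᵐᵒᵖ
  f : Ω →ₗ[Rᵐᵒᵖ] X
  k : K →ₗ[Rᵐᵒᵖ] Ω
  g : P →ₗ[Rᵐᵒᵖ] K
  h : Ω' →ₗ[Rᵐᵒᵖ] P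
  envelope : IsEnvelope e f
  kernel_envelope : IsKernel k f
  cover : IsProjectiveCover g
  kernel_cover : IsKernel h g

theorem nonempty_constructionStep [IsNoetherianRing Rᵐᵒᵖ] (hR : IsSemiperfect R) {e : R}
    (he : IsIdempotentElem e) (Ω : FGModuleCat.{u} Rᵐᵒᵖ) : Nonempty (ConstructionStep e Ω) := by
  obtain ⟨P, _, _, g, hP, hg⟩ := hR.exists_isProjectiveCover (traceSubmodule e Ω)
  exact ⟨{
    X := FGModuleCat.of Rᵐᵒᵖ (Ω ⧸ traceSubmodule e Ω)
    K := FGModuleCat.of Rᵐᵒᵖ (traceSubmodule e Ω)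
    P := FGModuleCat.of Rᵐᵒᵖ P
    Ω' := FGModuleCat.of Rᵐᵒᵖ (LinearMap.ker g)
    f := (traceSubmodule e Ω).mkQ
    k := (traceSubmodule e Ω).subtype
    g := g
    h := (LinearMap.ker g).subtype
    envelope := isEnvelope_mkQ he Ω
    kernel_envelope := ⟨Subtype.val_injective,
      (Submodule.range_subtype _).trans (Submodule.ker_mkQ _).symm⟩
    cover := hg
    kernel_cover := ⟨Subtype.val_injective, Submodule.range_subtype _⟩ }⟩

theorem exists_construction [IsNoetherianRing Rᵐᵒᵖ] (hR : IsSemiperfect R) {e : R}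
    (he : IsIdempotentElem e) (M : FGModuleCat.{u} Rᵐᵒᵖ) : ∃ D : Construction e, D.Ω 0 = M := by
  let step := fun Ω => (nonempty_constructionStep hR he Ω).some
  let Ω : ℕ → FGModuleCat.{u} Rᵐᵒᵖ := fun i => Nat.rec M (fun _ N => (step N).Ω') i
  exact ⟨{
    Ω := Ω
    X := fun i => (step (Ω i)).X
    K := fun i => (step (Ω i)).K
    P := fun i => (step (Ω i)).P
    f := fun i => (step (Ω i)).f
    k := fun i => (step (Ω i)).k
    g := fun i => (step (Ω i)).g
    h := fun i => (step (Ω i)).h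
    envelope := fun i => (step (Ω i)).envelope
    kernel_envelope := fun i => (step (Ω i)).kernel_envelope
    cover := fun i => (step (Ω i)).cover
    kernel_cover := fun i => (step (Ω i)).kernel_cover }, rfl⟩

end Existence

/-! ### Exactness and minimality of the resolution -/

section Resolution

variable {R : Type u} [Ring R] {e : R} (he : IsIdempotentElem e)

theorem isProjectiveCover_rangeRestrict {A : Type*} [Ring A] {P M : Type*} [AddCommGroup P]
    [Module A P] [AddCommGroup M] [Module A M] (hP : Module.Projective A P) {φ : P →ₗ[A] M}
    (hφ : IsSuperfluous (LinearMap.ker φ)) : IsProjectiveCover φ.rangeRestrict where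
  projective := hP
  surjective := LinearMap.surjective_rangeRestrict _
  superfluous := by rwa [LinearMap.ker_rangeRestrict]

namespace Construction

variable (D : Construction e)

include he in
theorem range_k (i : ℕ) : LinearMap.range (D.k i) = traceSubmodule e (D.Ω i) :=
  (D.kernel_envelope i).range_eq.trans ((D.envelope i).ker_eq he)

include he in
theorem traceSubmodule_P (i : ℕ) : traceSubmodule e (D.P i) = ⊤ :=
  (D.cover i).traceSubmodule_eq_top he
    (traceSubmodule_eq_top_of_range_eq (D.kernel_envelope i).injective (D.range_k he i))

/-- An element of Ω_i(1-e) lies in the trace, which is the image of k_i, so it lifts to P_i;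
multiplying the lift by 1-e moves it into P_i(1-e) without changing its image. -/
theorem surjective_Fmap (i : ℕ) : Function.Surjective (Fmap he (D.k i ∘ₗ D.g i)) := by
  intro z
  obtain ⟨y, hy⟩ := (D.range_k he i).ge (Submodule.subset_span (op_smul_evalF he z))
  obtain ⟨x, rfl⟩ := (D.cover i).surjective y
  obtain ⟨t, ht⟩ := exists_evalF_eq (e := e) (m := op (1 - e) • x)
    (by rw [smul_smul, ← op_mul, he.one_sub.eq])
  refine ⟨t, evalF_injective he ?_⟩
  rw [evalF_Fmap, ht, map_smul, LinearMap.comp_apply, hy, op_smul_evalF he]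

/-- Only the kernel of `φ` matters, so one statement covers both the augmentation and the
differentials. -/
theorem exact_Fmap_d (i : ℕ) {N : Type v} [AddCommGroup N] [Module Rᵐᵒᵖ N]
    {φ : D.P i →ₗ[Rᵐᵒᵖ] N} (hφ : LinearMap.ker φ = LinearMap.ker (D.g i)) :
    Function.Exact (Fmap he (D.d i)) (Fmap he φ) := by
  intro z
  rw [Fmap_eq_zero_iff, ← LinearMap.mem_ker, hφ, ← (D.kernel_cover i).range_eq]
  constructor
  · rintro ⟨y, hy⟩
    -- Since h_i is injective, the preimage in Ω_{i+1} of an element fixed by 1-e is itself fixed,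
    -- hence is reached from P_{i+1}(1-e).
    have hy' : op (1 - e) • y = y := (D.kernel_cover i).injective (by
      rw [map_smul, hy, op_smul_evalF he])
    obtain ⟨t, rfl⟩ := exists_evalF_eq hy'
    obtain ⟨s, rfl⟩ := D.surjective_Fmap he (i + 1) t
    refine ⟨s, evalF_injective he ?_⟩
    rw [evalF_Fmap] at hy ⊢
    exact hy
  · rintro ⟨s, rfl⟩
    rw [evalF_Fmap]
    exact ⟨_, rfl⟩

theorem ker_aug : LinearMap.ker D.aug = LinearMap.ker (D.g 0) :=
  LinearMap.ker_comp_of_ker_eq_bot _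
    (LinearMap.ker_eq_bot.mpr (D.kernel_envelope 0).injective)

theorem ker_d (i : ℕ) : LinearMap.ker (D.d i) = LinearMap.ker (D.g (i + 1)) := by
  rw [d, LinearMap.ker_comp_of_ker_eq_bot _
    (LinearMap.ker_eq_bot.mpr (D.kernel_cover i).injective),
    LinearMap.ker_comp_of_ker_eq_bot _
    (LinearMap.ker_eq_bot.mpr (D.kernel_envelope (i + 1)).injective)]

theorem isMinimalProjectiveResolution :
    IsMinimalProjectiveResolution (C := fun i => F e (D.P i)) (M := F e (D.Ω 0))
      (fun i => Fmap he (D.d i)) (Fmap he D.aug) where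
  finite i :=
    have := (D.cover i).projective
    (finite_projective_F he (D.traceSubmodule_P he i)).1
  exact_zero := D.exact_Fmap_d he 0 D.ker_aug
  exact_succ i := D.exact_Fmap_d he (i + 1) (D.ker_d i)
  cover_zero :=
    { projective :=
        have := (D.cover 0).projective
        (finite_projective_F he (D.traceSubmodule_P he 0)).2
      surjective := D.surjective_Fmap he 0
      superfluous := IsSuperfluous.ker_Fmap he (D.ker_aug ▸ (D.cover 0).superfluous)
        (D.traceSubmodule_P he 0) }
  cover_succ i :=
    have := (D.cover (i + 1)).projective
    isProjectiveCover_rangeRestrict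
      (finite_projective_F he (D.traceSubmodule_P he (i + 1))).2
      (IsSuperfluous.ker_Fmap he (D.ker_d i ▸ (D.cover (i + 1)).superfluous)
        (D.traceSubmodule_P he (i + 1)))

end Construction

end Resolution

end IdempotentReduction

theorem mainTheorem1 {R : Type u} [Ring R]
    (hleft : IsNoetherianRing R) (hright : IsNoetherianRing Rᵐᵒᵖ)
    (hsemi : IdempotentReduction.IsSemiperfect R) (hbasic : IdempotentReduction.IsBasic R)
    {e : R} (he : IsIdempotentElem e) (M : FGModuleCat.{u} Rᵐᵒᵖ) :
    (∃ D : IdempotentReduction.Construction e, D.Ω 0 = M) ∧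
    ∀ D : IdempotentReduction.Construction e, D.Ω 0 = M →
      IdempotentReduction.IsMinimalProjectiveResolution
        (C := fun i => IdempotentReduction.F e (D.P i))
        (M := IdempotentReduction.F e (D.Ω 0))
        (fun i => IdempotentReduction.Fmap he (D.d i))
        (IdempotentReduction.Fmap he D.aug) :=
  ⟨IdempotentReduction.exists_construction hsemi he M,
    fun D _ => D.isMinimalProjectiveResolution he⟩
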